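/- Consider a single shared link used by $N \ge 2$ users with data rates $x_1,\dots,x_N \ge 0$. Users $1$ and $N$ can perform inter-session network coding over the two zero-cost side links of a butterfly network, and users $2,\dots,N-1$ are routing users, so the load on the shared link is $q(\boldsymbol{x}) = \sum_{n=2}^{N-1} x_n + \max(x_1,x_N)$. The link has price function $p(q) = a q$ and cost function $C(q) = \int_0^q p(z)\,dz = \frac a2 q^2$ for some $a > 0$. Each user $n$ has a utility function $U_n$ on $[0,\infty)$ that is concave, non-negative, strictly increasing, continuous, and differentiable on $(0,\infty)$. The network surplus is $S(\boldsymbol{x}) = \sum_{n=1}^N U_n(x_n) - C(q(\boldsymbol{x}))$; let $\boldsymbol{x}^S$ denote a maximizer of $S$ over $\boldsymbol{x} \ge 0$. In the resource allocation game with discriminatory pricing parameter $\beta$, each user $n$ chooses $x_n \ge 0$ to maximize its payoff, which is $U_n(x_n) - \bigl(x_n - (1-\beta)\min(x_1,x_N)\bigr)\, p(q(\boldsymbol{x}))$ for $n \in \{1,N\}$ and $U_n(x_n) - x_n\, p(q(\boldsymbol{x}))$ for $2 \le n \le N-1$. A Nash equilibrium is a vector $\boldsymbol{x}^\ast \ge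 0$ at which no user can increase its payoff by unilaterally changing its rate to another non-negative value; its efficiency is $S(\boldsymbol{x}^\ast)/S(\boldsymbol{x}^S)$. The price of anarchy is the worst-case efficiency, that is, the infimum of the efficiency over all $N \ge 2$, all $a > 0$, all such utility functions, and all Nash equilibria. Let $\beta = \frac12$. Then: (a) The price of anarchy equals $\frac14$. (b) The worst case occurs as $N \to \infty$: if $w_N$ denotes the infimum of the efficiency over all systems with exactly $N$ users, then $w_N > \frac14$ for every $N \ge 2$, and $w_N \to \frac14$ as $N \to \infty$. -/

import Mathlib

namespace Butterfly

open Set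

/-- Admissible utility functions of a data rate `x ≥ 0`: concave, non-negative, (strictly)
increasing, continuous up to rate `0`, and differentiable at every positive rate. -/
structure IsUtility (U : ℝ → ℝ) : Prop where
  concave : ConcaveOn ℝ (Ici 0) U
  nonneg : ∀ x ∈ Ici (0 : ℝ), 0 ≤ U x
  increasing : StrictMonoOn U (Ici 0)
  continuous : ContinuousOn U (Ici 0)
  differentiable : DifferentiableOn ℝ U (Ioi 0)

/-- The linear price function `p(q) = a q` of the shared link. -/
def price (a q : ℝ) : ℝ := a * q

/-- The quadratic cost function `C(q) = (a / 2) q ^ 2` of the shared link. -/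
noncomputable def cost (a q : ℝ) : ℝ := a / 2 * q ^ 2

/-- The cost is the integral of the price. -/
theorem cost_eq_integral (a q : ℝ) : cost a q = ∫ z in (0 : ℝ)..q, price a z := by
  unfold cost price
  rw [intervalIntegral.integral_const_mul, integral_id]
  ring

/-! The network has `N = k + 2` users, indexed by `Fin (k + 2)`. The two network coding users
(users `1` and `N`) are the first and the last index; the other `k` users are routing users. -/

/-- User `1`. -/
def firstUser (k : ℕ) : Fin (k + 2) := 0

/-- User `N`. -/
def lastUser (k : ℕ) : Fin (k + 2) := Fin.last (k + 1)

/-- The routing users `2, …, N - 1`. -/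
def routingUser {k : ℕ} (i : Fin k) : Fin (k + 2) := i.castSucc.succ

/-- The routing users are exactly the users other than the two network coding users. -/
theorem exists_routingUser_iff {k : ℕ} (n : Fin (k + 2)) :
    (∃ i : Fin k, routingUser i = n) ↔ n ≠ firstUser k ∧ n ≠ lastUser k := by
  simp only [routingUser, firstUser, lastUser, Fin.ext_iff, Fin.val_succ, Fin.val_castSucc,
    Fin.val_zero, Fin.val_last, ne_eq]
  constructor
  · rintro ⟨i, hi⟩
    have := i.isLt
    omega
  · rintro ⟨h0, h1⟩
    have := n.isLt
    exact ⟨⟨n - 1, by omega⟩, by simp only []; omega⟩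

/-- Aggregate rate on the shared link: the packets of users `1` and `N` are coded jointly at rate
`min (x 1) (x N)`, so that these two users together load the link with `max (x 1) (x N)`. -/
def load {k : ℕ} (x : Fin (k + 2) → ℝ) : ℝ :=
  (∑ i : Fin k, x (routingUser i)) + max (x (firstUser k)) (x (lastUser k))

/-- Network aggregate surplus at the rate vector `x`. -/
noncomputable def surplus {k : ℕ} (a : ℝ) (U : Fin (k + 2) → ℝ → ℝ) (x : Fin (k + 2) → ℝ) : ℝ :=
  (∑ n, U n (x n)) - cost a (load x)

/-- `x` is an optimal solution of the surplus maximization problem over non-negative rates. -/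
def IsOptimal {k : ℕ} (a : ℝ) (U : Fin (k + 2) → ℝ → ℝ) (x : Fin (k + 2) → ℝ) : Prop :=
  (∀ n, 0 ≤ x n) ∧ ∀ y : Fin (k + 2) → ℝ, (∀ n, 0 ≤ y n) → surplus a U y ≤ surplus a U x

/-- Rate for which user `n` is charged, in units of the price for routed packets: the coded part
`min (x 1) (x N)` of the rate of a network coding user is charged at the fraction `β`. -/
noncomputable def chargedRate {k : ℕ} (β : ℝ) (x : Fin (k + 2) → ℝ) (n : Fin (k + 2)) : ℝ :=
  if n = firstUser k ∨ n = lastUser k then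
    x n - (1 - β) * min (x (firstUser k)) (x (lastUser k))
  else x n

/-- Payoff of user `n`: utility minus payment. -/
noncomputable def payoff {k : ℕ} (β a : ℝ) (U : Fin (k + 2) → ℝ → ℝ) (n : Fin (k + 2))
    (x : Fin (k + 2) → ℝ) : ℝ :=
  U n (x n) - chargedRate β x n * price a (load x)

/-- Nash equilibria: non-negative rate vectors at which no user gains by a unilateral change of
its rate to another non-negative rate. -/
def IsNash {k : ℕ} (β a : ℝ) (U : Fin (k + 2) → ℝ → ℝ) (x : Fin (k + 2) → ℝ) : Prop :=
  (∀ n, 0 ≤ x n) ∧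
    ∀ n, ∀ y : ℝ, 0 ≤ y → payoff β a U n (Function.update x n y) ≤ payoff β a U n x

/-- All efficiencies (surplus at a Nash equilibrium divided by optimal surplus) that occur in
networks with `k` routing users, over all admissible utilities and all prices `p(q) = a q`. -/
def efficiencies (β : ℝ) (k : ℕ) : Set ℝ :=
  {e | ∃ (a : ℝ) (U : Fin (k + 2) → ℝ → ℝ) (x xS : Fin (k + 2) → ℝ),
    0 < a ∧ (∀ n, IsUtility (U n)) ∧ IsNash β a U x ∧ IsOptimal a U xS ∧
      e = surplus a U x / surplus a U xS}

/-- `r` is the price of anarchy: the worst-case (greatest lower bound of the) efficiency over all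
numbers `N = k + 2 ≥ 2` of users and all choices of the other system parameters. -/
def IsPriceOfAnarchy (β r : ℝ) : Prop := IsGLB (⋃ k : ℕ, efficiencies β k) r

end Butterfly

namespace Butterfly

open Set

/-! Lower bound: at an equilibrium `x` each utility has a supporting line at `x n`, with slope `a *
r n` given by the marginal payment. Let `T` be the sum of the intercepts at rate `0`, non-negative
because utilities are, and let `q` be the load. The surplus at `x` is `T + a * F`, where `F` is `∑ r
n * x n - q ^ 2 / 2`. A unit of load carries one unit of one routing user or of both coding users at
once, so if `M` bounds every routing slope and the sum of the two coding slopes, every surplus is at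
most `T + a * M ^ 2 / 2`. It remains to show `c * M ^ 2 / 2 ≤ F` for some `c ≤ 1`, a quadratic
inequality in the rates (`exists_coding_supergradients`, `efficiency_lower_bound`).

The constant `c = 1 / 4` is critical only when the coding users are silent, each with slope `a * q`,
and the routing users are infinitesimal. With `k` routing users of total rate `R`, Cauchy-Schwarz
keeps their sum of squares above `R ^ 2 / (k + 1)`, which improves `c` by a multiple of `1 / (k +
1)`. Linear utilities near this critical case give efficiency `1 / 4 + 1 / (2 * k)`
(`quarter_add_mem_efficiencies`), hence sharpness and the limit. -/

/-! ### Coordinates and unilateral deviations -/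

theorem sum_univ_eq {k : ℕ} (f : Fin (k + 2) → ℝ) :
    ∑ n, f n = f (firstUser k) + f (lastUser k) + ∑ i : Fin k, f (routingUser i) := by
  rw [Fin.sum_univ_succ, Fin.sum_univ_castSucc]
  simp only [firstUser, lastUser, routingUser, Fin.succ_last]
  ring

theorem firstUser_ne_lastUser (k : ℕ) : firstUser k ≠ lastUser k := by
  simp [firstUser, lastUser, Fin.ext_iff]

theorem routingUser_ne_firstUser {k : ℕ} (i : Fin k) : routingUser i ≠ firstUser k :=
  ((exists_routingUser_iff _).1 ⟨i, rfl⟩).1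

theorem routingUser_ne_lastUser {k : ℕ} (i : Fin k) : routingUser i ≠ lastUser k :=
  ((exists_routingUser_iff _).1 ⟨i, rfl⟩).2

theorem routingUser_injective {k : ℕ} : Function.Injective (routingUser (k := k)) :=
  (Fin.succ_injective _).comp (Fin.castSucc_injective _)

theorem forall_user_iff {k : ℕ} (p : Fin (k + 2) → Prop) :
    (∀ n, p n) ↔ p (firstUser k) ∧ p (lastUser k) ∧ ∀ i : Fin k, p (routingUser i) := by
  refine ⟨fun h => ⟨h _, h _, fun i => h _⟩, fun ⟨h1, h2, h3⟩ n => ?_⟩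
  by_cases hn : n ≠ firstUser k ∧ n ≠ lastUser k
  · obtain ⟨i, rfl⟩ := (exists_routingUser_iff n).2 hn
    exact h3 i
  · by_cases hf : n = firstUser k
    · exact hf ▸ h1
    · have hl : n = lastUser k := by tauto
      exact hl ▸ h2

theorem load_update_first {k : ℕ} (x : Fin (k + 2) → ℝ) (y : ℝ) :
    load (Function.update x (firstUser k) y) =
      (∑ i : Fin k, x (routingUser i)) + max y (x (lastUser k)) := by
  simp [load, routingUser_ne_firstUser, (firstUser_ne_lastUser k).symm]

theorem load_update_last {k : ℕ} (x : Fin (k + 2) → ℝ) (y : ℝ) :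
    load (Function.update x (lastUser k) y) =
      (∑ i : Fin k, x (routingUser i)) + max (x (firstUser k)) y := by
  simp [load, routingUser_ne_lastUser, firstUser_ne_lastUser k]

theorem load_update_routing {k : ℕ} (x : Fin (k + 2) → ℝ) (i : Fin k) (y : ℝ) :
    load (Function.update x (routingUser i) y) = load x - x (routingUser i) + y := by
  have h : ∀ j : Fin k, Function.update x (routingUser i) y (routingUser j) =
      x (routingUser j) + if j = i then y - x (routingUser i) else 0 := by
    intro j
    by_cases hj : j = i
    · subst hj; simp
    · simp [hj, routingUser_injective.ne hj]
  simp only [load, h, Finset.sum_add_distrib, Finset.sum_ite_eq', Finset.mem_univ, if_true,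
    Function.update_of_ne (routingUser_ne_firstUser i).symm,
    Function.update_of_ne (routingUser_ne_lastUser i).symm]
  ring

/-- Payoff of a network coding user with own rate `y`, when the other network coding user sends at
rate `z` and the routing users send at total rate `R`. -/
noncomputable def codingPayoff (a R z : ℝ) (U : ℝ → ℝ) (y : ℝ) : ℝ :=
  U y - (y - 1 / 2 * min y z) * (a * (R + max y z))

theorem payoff_update_first {k : ℕ} (a : ℝ) (U : Fin (k + 2) → ℝ → ℝ) (x : Fin (k + 2) → ℝ)
    (y : ℝ) : payoff (1 / 2) a U (firstUser k) (Function.update x (firstUser k) y) =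
      codingPayoff a (∑ i : Fin k, x (routingUser i)) (x (lastUser k)) (U (firstUser k)) y := by
  simp only [payoff, chargedRate, price, load_update_first, codingPayoff, Function.update_self,
    Function.update_of_ne (firstUser_ne_lastUser k).symm, true_or, if_true]
  norm_num

theorem payoff_update_last {k : ℕ} (a : ℝ) (U : Fin (k + 2) → ℝ → ℝ) (x : Fin (k + 2) → ℝ)
    (y : ℝ) : payoff (1 / 2) a U (lastUser k) (Function.update x (lastUser k) y) =
      codingPayoff a (∑ i : Fin k, x (routingUser i)) (x (firstUser k)) (U (lastUser k)) y := by
  simp only [payoff, chargedRate, price, load_update_last, codingPayoff, Function.update_self,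
    Function.update_of_ne (firstUser_ne_lastUser k), or_true, if_true]
  rw [min_comm, max_comm]
  norm_num

theorem payoff_update_routing {k : ℕ} (a : ℝ) (U : Fin (k + 2) → ℝ → ℝ) (x : Fin (k + 2) → ℝ)
    (i : Fin k) (y : ℝ) :
    payoff (1 / 2) a U (routingUser i) (Function.update x (routingUser i) y) =
      U (routingUser i) y - y * (a * (load x - x (routingUser i) + y)) := by
  simp [payoff, chargedRate, price, load_update_routing, routingUser_ne_firstUser,
    routingUser_ne_lastUser]

/-- The equilibrium conditions of the network coding users and of the routing users. -/
theorem isNash_iff {k : ℕ} (a : ℝ) (U : Fin (k + 2) → ℝ → ℝ) (x : Fin (k + 2) → ℝ) :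
    IsNash (1 / 2) a U x ↔ (∀ n, 0 ≤ x n) ∧
      (∀ y, 0 ≤ y →
        codingPayoff a (∑ i : Fin k, x (routingUser i)) (x (lastUser k)) (U (firstUser k)) y ≤
        codingPayoff a (∑ i : Fin k, x (routingUser i)) (x (lastUser k)) (U (firstUser k))
          (x (firstUser k))) ∧
      (∀ y, 0 ≤ y →
        codingPayoff a (∑ i : Fin k, x (routingUser i)) (x (firstUser k)) (U (lastUser k)) y ≤
        codingPayoff a (∑ i : Fin k, x (routingUser i)) (x (firstUser k)) (U (lastUser k))
          (x (lastUser k))) ∧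
      ∀ (i : Fin k) (y : ℝ), 0 ≤ y →
        U (routingUser i) y - y * (a * (load x - x (routingUser i) + y)) ≤
        U (routingUser i) (x (routingUser i)) - x (routingUser i) * (a * load x) := by
  have key : ∀ n, payoff (1 / 2) a U n x = payoff (1 / 2) a U n (Function.update x n (x n)) :=
    fun n => by rw [Function.update_eq_self]
  rw [IsNash, forall_user_iff (p := fun n => ∀ y : ℝ, 0 ≤ y →
    payoff (1 / 2) a U n (Function.update x n y) ≤ payoff (1 / 2) a U n x)]
  simp only [key, payoff_update_first, payoff_update_last, payoff_update_routing,
    sub_add_cancel]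

/-! ### Supporting lines from equilibrium conditions -/

/-- A concave function that stays below a parabola with slope `p` to the right of `x` stays below
the line with slope `p`. -/
theorem le_line_right {U : ℝ → ℝ} (hU : ConcaveOn ℝ (Ici 0) U) {x p C ε : ℝ} (hx : 0 ≤ x)
    (hε : 0 < ε) (h : ∀ t, 0 ≤ t → t ≤ ε → U (x + t) ≤ U x + p * t + C * t ^ 2) {y : ℝ}
    (hy : x ≤ y) : U y ≤ U x + p * (y - x) := by
  rcases hy.eq_or_lt with rfl | hy
  · simp
  have hd : 0 < y - x := sub_pos.2 hy
  -- By concavity the slope of the chord to `y` is at most that to the nearby point `x + l * (y -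
  -- x)`; the quadratic error then contributes only `O(l)`, which vanishes as `l → 0`.
  have key : ∀ l : ℝ, 0 < l → l ≤ 1 → l * (y - x) ≤ ε →
      U y - U x - p * (y - x) ≤ C * (y - x) ^ 2 * l := by
    intro l hl hl1 hle
    have h1 := hU.2 (mem_Ici.2 hx) (mem_Ici.2 (hx.trans hy.le)) (sub_nonneg.2 hl1) hl.le
      (by ring)
    have h2 := h (l * (y - x)) (by positivity) hle
    simp only [smul_eq_mul] at h1
    rw [show (1 - l) * x + l * y = x + l * (y - x) by ring] at h1
    refine le_of_mul_le_mul_left ?_ hl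
    nlinarith
  have hlim : Filter.Tendsto (fun l : ℝ => C * (y - x) ^ 2 * l) (nhdsWithin 0 (Ioi 0))
      (nhds (C * (y - x) ^ 2 * 0)) :=
    (Continuous.tendsto (by fun_prop) _).mono_left nhdsWithin_le_nhds
  have hev : ∀ᶠ l in nhdsWithin (0 : ℝ) (Ioi 0),
      U y - U x - p * (y - x) ≤ C * (y - x) ^ 2 * l := by
    filter_upwards [Ioo_mem_nhdsGT (show (0 : ℝ) < min 1 (ε / (y - x)) by positivity)] with l hl
    have := hl.2
    rw [lt_min_iff, lt_div_iff₀ hd] at this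
    exact key l hl.1 this.1.le this.2.le
  have := ge_of_tendsto hlim hev
  linarith

theorem le_line_left {U : ℝ → ℝ} (hU : ConcaveOn ℝ (Ici 0) U) {x p C ε : ℝ}
    (hε : 0 < ε) (h : ∀ t, 0 ≤ t → t ≤ ε → t ≤ x → U (x - t) ≤ U x - p * t + C * t ^ 2) {y : ℝ}
    (hy0 : 0 ≤ y) (hy : y ≤ x) : U y ≤ U x + p * (y - x) := by
  rcases hy.eq_or_lt with rfl | hy
  · simp
  have hd : 0 < x - y := sub_pos.2 hy
  have key : ∀ l : ℝ, 0 < l → l ≤ 1 → l * (x - y) ≤ ε →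
      U y - U x - p * (y - x) ≤ C * (x - y) ^ 2 * l := by
    intro l hl hl1 hle
    have h1 := hU.2 (mem_Ici.2 (hy0.trans hy.le)) (mem_Ici.2 hy0) (sub_nonneg.2 hl1) hl.le
      (by ring)
    have h2 := h (l * (x - y)) (by positivity) hle (by nlinarith)
    simp only [smul_eq_mul] at h1
    rw [show (1 - l) * x + l * y = x - l * (x - y) by ring] at h1
    refine le_of_mul_le_mul_left ?_ hl
    nlinarith
  have hlim : Filter.Tendsto (fun l : ℝ => C * (x - y) ^ 2 * l) (nhdsWithin 0 (Ioi 0))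
      (nhds (C * (x - y) ^ 2 * 0)) :=
    (Continuous.tendsto (by fun_prop) _).mono_left nhdsWithin_le_nhds
  have hev : ∀ᶠ l in nhdsWithin (0 : ℝ) (Ioi 0),
      U y - U x - p * (y - x) ≤ C * (x - y) ^ 2 * l := by
    filter_upwards [Ioo_mem_nhdsGT (show (0 : ℝ) < min 1 (ε / (x - y)) by positivity)] with l hl
    have := hl.2
    rw [lt_min_iff, lt_div_iff₀ hd] at this
    exact key l hl.1 this.1.le this.2.le
  have := ge_of_tendsto hlim hev
  linarith

/-- `s` is a slope of a line through `(x, U x)` that lies above `U` on the non-negative reals. -/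
def IsSupergradient (U : ℝ → ℝ) (x s : ℝ) : Prop := ∀ y, 0 ≤ y → U y ≤ U x + s * (y - x)

/-- `pl` and `pr` play the left and right marginal payments at a best response. The two one-sided
bounds merge into one line by differentiability if `0 < x`; at `x = 0` only the right one matters.
-/
theorem IsUtility.exists_isSupergradient {U : ℝ → ℝ} (hU : IsUtility U) {x pl pr C ε : ℝ}
    (hx : 0 ≤ x) (hp : pl ≤ pr) (hε : 0 < ε)
    (hr : ∀ t, 0 ≤ t → t ≤ ε → U (x + t) ≤ U x + pr * t + C * t ^ 2)
    (hl : ∀ t, 0 ≤ t → t ≤ ε → t ≤ x → U (x - t) ≤ U x - pl * t + C * t ^ 2) :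
    ∃ s, pl ≤ s ∧ s ≤ pr ∧ IsSupergradient U x s := by
  have hR : ∀ y, x ≤ y → U y ≤ U x + pr * (y - x) :=
    fun y hy => le_line_right hU.concave hx hε hr hy
  have hL : ∀ y, 0 ≤ y → y ≤ x → U y ≤ U x + pl * (y - x) :=
    fun y hy0 hy => le_line_left hU.concave hε hl hy0 hy
  rcases hx.eq_or_lt with rfl | hx0
  · exact ⟨pr, hp, le_rfl, fun y hy => hR y hy⟩
  have hd : HasDerivAt U (deriv U x) x :=
    ((hU.differentiable x hx0).differentiableAt (Ioi_mem_nhds hx0)).hasDerivAt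
  set s := deriv U x
  have hsR : ∀ y, x ≤ y → U y ≤ U x + s * (y - x) := by
    intro y hy
    rcases hy.eq_or_lt with rfl | hy
    · simp
    have := hU.concave.slope_le_of_hasDerivAt (mem_Ici.2 hx) (mem_Ici.2 (hx.trans hy.le)) hy hd
    rw [slope_def_field, div_le_iff₀ (sub_pos.2 hy)] at this
    linarith
  have hsL : ∀ y, 0 ≤ y → y ≤ x → U y ≤ U x + s * (y - x) := by
    intro y hy0 hy
    rcases hy.eq_or_lt with rfl | hy
    · simp
    have := hU.concave.le_slope_of_hasDerivAt (mem_Ici.2 hy0) (mem_Ici.2 hx) hy hd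
    rw [slope_def_field, le_div_iff₀ (sub_pos.2 hy)] at this
    linarith
  -- Clamping the derivative to `[pl, pr]` spares proving that it lies there: on each side of `x`
  -- the clamped line dominates one of the bounds already known.
  refine ⟨max pl (min s pr), le_max_left _ _, max_le hp (min_le_right _ _), fun y hy0 => ?_⟩
  rcases le_total x y with hy | hy
  · have h1 : min s pr * (y - x) ≤ max pl (min s pr) * (y - x) :=
      mul_le_mul_of_nonneg_right (le_max_right _ _) (sub_nonneg.2 hy)
    rcases min_choice s pr with h | h <;> rw [h] at h1 ⊢
    · linarith [hsR y hy]
    · linarith [hR y hy]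
  · rcases max_choice pl (min s pr) with h | h <;> rw [h]
    · exact hL y hy0 hy
    · have h1 : s * (y - x) ≤ min s pr * (y - x) :=
        mul_le_mul_of_nonpos_right (min_le_left _ _) (sub_nonpos.2 hy)
      linarith [hsL y hy0 hy]

/-- The marginal payment is the price `a * q` plus `a * x`, the effect of the user's own rate on the
price. -/
theorem isSupergradient_routing {U : ℝ → ℝ} (hU : IsUtility U) {a q x : ℝ}
    (hx : 0 ≤ x) (h : ∀ y, 0 ≤ y → U y - y * (a * (q - x + y)) ≤ U x - x * (a * q)) :
    IsSupergradient U x (a * (q + x)) := by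
  obtain ⟨s, h1, h2, h3⟩ := hU.exists_isSupergradient (pl := a * (q + x)) (pr := a * (q + x))
    (C := a) (ε := 1) hx le_rfl one_pos
    (fun t ht _ => by have := h (x + t) (by positivity); nlinarith)
    (fun t ht _ htx => by have := h (x - t) (by linarith); nlinarith)
  rwa [le_antisymm h2 h1] at h3

/-- At equal rates, the prices seen by a network coding user are bounded by the one-sided
derivatives of its payment. -/
theorem exists_isSupergradient_of_eq {U : ℝ → ℝ} (hU : IsUtility U) {a R x : ℝ} (ha : 0 < a)
    (hR : 0 ≤ R) (hx : 0 ≤ x) (h : ∀ y, 0 ≤ y → codingPayoff a R x U y ≤ codingPayoff a R x U x) :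
    ∃ r, (R + x) / 2 ≤ r ∧ r ≤ R + x + x / 2 ∧ IsSupergradient U x (a * r) := by
  obtain ⟨s, h1, h2, h3⟩ := hU.exists_isSupergradient (pl := a * ((R + x) / 2))
    (pr := a * (R + x + x / 2)) (C := a) (ε := 1) hx
    (mul_le_mul_of_nonneg_left (by linarith) ha.le) one_pos
    (fun t ht _ => by
      have := h (x + t) (by positivity)
      simp only [codingPayoff, min_self, max_self] at this
      rw [min_eq_right (by linarith), max_eq_left (by linarith)] at this
      nlinarith)
    (fun t ht _ htx => by
      have := h (x - t) (by linarith)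
      simp only [codingPayoff, min_self, max_self] at this
      rw [min_eq_left (by linarith), max_eq_right (by linarith)] at this
      have : 0 ≤ a * t ^ 2 := by positivity
      nlinarith)
  refine ⟨s / a, ?_, ?_, by rwa [mul_div_cancel₀ _ ha.ne']⟩
  · rw [le_div_iff₀ ha]; linarith
  · rw [div_le_iff₀ ha]; linarith

/-- The faster coding user sets the load, so its payment is locally `(y - z / 2) * (a * (R + y))`;
`ε = x - z` stays on this piece. -/
theorem isSupergradient_of_gt {U : ℝ → ℝ} (hU : IsUtility U) {a R x z : ℝ}
    (hz : 0 ≤ z) (hzx : z < x)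
    (h : ∀ y, 0 ≤ y → codingPayoff a R z U y ≤ codingPayoff a R z U x) :
    IsSupergradient U x (a * (R + x + x - z / 2)) := by
  obtain ⟨s, h1, h2, h3⟩ := hU.exists_isSupergradient (pl := a * (R + x + x - z / 2))
    (pr := a * (R + x + x - z / 2)) (C := a) (ε := x - z) (hz.trans hzx.le) le_rfl
    (sub_pos.2 hzx)
    (fun t ht _ => by
      have := h (x + t) (by linarith)
      simp only [codingPayoff] at this
      rw [min_eq_right (by linarith), max_eq_left (by linarith), min_eq_right hzx.le,
        max_eq_left hzx.le] at this
      nlinarith)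
    (fun t ht htz htx => by
      have := h (x - t) (by linarith)
      simp only [codingPayoff] at this
      rw [min_eq_right (by linarith), max_eq_left (by linarith), min_eq_right hzx.le,
        max_eq_left hzx.le] at this
      nlinarith)
  rwa [le_antisymm h2 h1] at h3

/-- The slower coding user does not affect the load: its payment is locally linear at half the
price, so `C = 0`. -/
theorem isSupergradient_of_lt {U : ℝ → ℝ} (hU : IsUtility U) {a R x z : ℝ}
    (hz : 0 ≤ z) (hzx : z < x)
    (h : ∀ y, 0 ≤ y → codingPayoff a R x U y ≤ codingPayoff a R x U z) :
    IsSupergradient U z (a * ((R + x) / 2)) := by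
  obtain ⟨s, h1, h2, h3⟩ := hU.exists_isSupergradient (pl := a * ((R + x) / 2))
    (pr := a * ((R + x) / 2)) (C := 0) (ε := x - z) hz le_rfl
    (sub_pos.2 hzx)
    (fun t ht htz => by
      have := h (z + t) (by linarith)
      simp only [codingPayoff] at this
      rw [min_eq_left (by linarith), max_eq_right (by linarith), min_eq_left hzx.le,
        max_eq_right hzx.le] at this
      nlinarith)
    (fun t ht htz htx => by
      have := h (z - t) (by linarith)
      simp only [codingPayoff] at this
      rw [min_eq_left (by linarith), max_eq_right (by linarith), min_eq_left hzx.le,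
        max_eq_right hzx.le] at this
      nlinarith)
  rwa [le_antisymm h2 h1] at h3

/-! ### Quadratic inequalities for the coding users -/

/-- Right minus left is concave in `σ`, so the ends of the interval for `σ` decide. At `d = 0`
equality holds for `x = 0`, `σ = 2 * R`; the `d * R ^ 2` term pays for `d / 200` near there, and `(R
+ x) * x` pays elsewhere. -/
theorem equal_rate_bound {R x σ d : ℝ} (hR : 0 ≤ R) (hx : 0 ≤ x) (hd0 : 0 ≤ d) (hd1 : d ≤ 1)
    (h1 : R + x ≤ σ) (h2 : σ ≤ 2 * (R + x) + x) :
    (1 / 8 + d / 200) * σ ^ 2 ≤ d * R ^ 2 + (R + x) * R + σ * x - (R + x) ^ 2 / 2 := by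
  have e1 : 0 ≤ (σ - (R + x)) * (2 * (R + x) + x - σ) := mul_nonneg (by linarith) (by linarith)
  have hRx := mul_nonneg hR hx
  have hdR : 0 ≤ d * (R * x) := by positivity
  have hdRR : 0 ≤ d * R ^ 2 := by positivity
  have hdxx : 0 ≤ d * x ^ 2 := by positivity
  have hdx : d * ((R + x) * x) ≤ (R + x) * x := mul_le_of_le_one_left (by positivity) hd1
  have hb : σ ^ 2 ≤ 9 * (R + x) ^ 2 := by
    have := pow_le_pow_left₀ (show 0 ≤ σ by linarith) (show σ ≤ 3 * (R + x) by linarith) 2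
    linarith
  have hb2 : d * σ ^ 2 ≤ d * (9 * (R + x) ^ 2) := mul_le_mul_of_nonneg_left hb hd0
  have hdq : 9 / 200 * (d * (R + x) ^ 2) ≤ d * R ^ 2 + 1 / 2 * ((R + x) * x) := by linarith
  have hdq' : 9 / 200 * (d * (R + x) ^ 2) ≤ 9 / 200 * (R + x) ^ 2 := by
    have := mul_le_of_le_one_left (sq_nonneg (R + x)) hd1
    linarith
  -- Bounding `σ ^ 2` by `e1` leaves an expression linear in `σ` with slope `(7 * x - 3 * (R + x)) /
  -- 8`, whose sign selects the endpoint.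
  rcases le_total (3 * (R + x)) (7 * x) with h | h
  · have := mul_nonneg (sub_nonneg.2 h) (sub_nonneg.2 h1)
    nlinarith
  · have := mul_nonneg (sub_nonneg.2 h) (sub_nonneg.2 h2)
    nlinarith

/-- Not critical: there is room to bound the constant by `13 / 100`, its value at `d = 1`, and to
drop `d * R ^ 2`. -/
theorem unequal_rate_bound {R x z d : ℝ} (hR : 0 ≤ R) (hz : 0 ≤ z) (hzx : z ≤ x) (hd0 : 0 ≤ d)
    (hd1 : d ≤ 1) :
    (1 / 8 + d / 200) * ((R + x + x - z / 2) + (R + x) / 2) ^ 2 ≤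
      d * R ^ 2 + (R + x) * R + ((R + x + x - z / 2) * x + (R + x) / 2 * z) - (R + x) ^ 2 / 2 := by
  have hx := hz.trans hzx
  have h1 : ((R + x + x - z / 2) + (R + x) / 2) ^ 2 ≤ (3 / 2 * (R + x) + x) ^ 2 := by
    apply pow_le_pow_left₀ <;> linarith
  have h2 : (1 / 8 + d / 200) * ((R + x + x - z / 2) + (R + x) / 2) ^ 2 ≤
      13 / 100 * (3 / 2 * (R + x) + x) ^ 2 :=
    mul_le_mul (by linarith) h1 (by positivity) (by norm_num)
  have h3 : 0 ≤ z * R := mul_nonneg hz hR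
  have h4 : 0 ≤ d * R ^ 2 := by positivity
  nlinarith [sq_nonneg ((R + x) - x), sq_nonneg ((R + x) - 2 * x), sq_nonneg x]

/-- Marginal utilities of the two network coding users at an equilibrium. -/
theorem exists_coding_supergradients {U V : ℝ → ℝ} (hU : IsUtility U) (hV : IsUtility V)
    {a R u v : ℝ} (ha : 0 < a) (hR : 0 ≤ R) (hu : 0 ≤ u) (hv : 0 ≤ v)
    (hNU : ∀ y, 0 ≤ y → codingPayoff a R v U y ≤ codingPayoff a R v U u)
    (hNV : ∀ y, 0 ≤ y → codingPayoff a R u V y ≤ codingPayoff a R u V v) :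
    ∃ r r', 0 ≤ r ∧ 0 ≤ r' ∧ IsSupergradient U u (a * r) ∧ IsSupergradient V v (a * r') ∧
      r ≤ 2 * (R + max u v) ∧
      (R + max u v) ≤ r + r' ∧ (R + max u v) * max u v ≤ r * u + r' * v ∧
      ∀ d, 0 ≤ d → d ≤ 1 → (1 / 8 + d / 200) * (r + r') ^ 2 ≤
        d * R ^ 2 + (R + max u v) * R + (r * u + r' * v) - (R + max u v) ^ 2 / 2 := by
  rcases lt_trichotomy u v with huv | rfl | huv
  · have h1 := isSupergradient_of_lt hU hu huv hNU
    have h2 := isSupergradient_of_gt hV hu huv hNV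
    rw [max_eq_right huv.le]
    refine ⟨_, _, by positivity, by linarith, h1, h2, by linarith, by linarith, by nlinarith,
      fun d hd0 hd1 => ?_⟩
    have := unequal_rate_bound hR hu huv.le hd0 hd1
    rw [add_comm ((R + v) / 2), add_comm ((R + v) / 2 * u)]
    exact this
  · obtain ⟨r, h1, h2, h3⟩ := exists_isSupergradient_of_eq hU ha hR hu hNU
    obtain ⟨r', h1', h2', h3'⟩ := exists_isSupergradient_of_eq hV ha hR hu hNV
    rw [max_self]
    refine ⟨r, r', by linarith, by linarith, h3, h3', by linarith, by linarith, by nlinarith,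
      fun d hd0 hd1 => ?_⟩
    rw [← add_mul]
    exact equal_rate_bound hR hu hd0 hd1 (by linarith) (by linarith)
  · have h1 := isSupergradient_of_lt hV hv huv hNV
    have h2 := isSupergradient_of_gt hU hv huv hNU
    rw [max_eq_left huv.le]
    exact ⟨_, _, by linarith, by positivity, h2, h1, by linarith, by linarith, by nlinarith,
      fun d hd0 hd1 => unequal_rate_bound hR hv huv.le hd0 hd1⟩

/-! ### Lower bound on the efficiency -/

/-- Comparison of the surplus at `y` with the linearization of the utilities at `x`. -/
theorem surplus_le_of_isSupergradient {k : ℕ} {a M : ℝ} {U : Fin (k + 2) → ℝ → ℝ}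
    {x y r : Fin (k + 2) → ℝ} (ha : 0 < a)
    (hs : ∀ n, IsSupergradient (U n) (x n) (a * r n)) (hy : ∀ n, 0 ≤ y n)
    (hf : 0 ≤ r (firstUser k)) (hl : 0 ≤ r (lastUser k))
    (hM : r (firstUser k) + r (lastUser k) ≤ M) (hMi : ∀ i : Fin k, r (routingUser i) ≤ M) :
    surplus a U y ≤ ∑ n, (U n (x n) - a * r n * x n) + a * M ^ 2 / 2 := by
  have h1 : ∑ n, U n (y n) ≤ ∑ n, (U n (x n) - a * r n * x n) + a * ∑ n, r n * y n := by
    rw [Finset.mul_sum, ← Finset.sum_add_distrib]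
    refine Finset.sum_le_sum fun n _ => ?_
    have := hs n (y n) (hy n)
    linarith
  have h2 : ∑ n, r n * y n ≤ M * load y := by
    rw [sum_univ_eq, load, mul_add, Finset.mul_sum]
    have h3 : ∑ i : Fin k, r (routingUser i) * y (routingUser i) ≤
        ∑ i : Fin k, M * y (routingUser i) :=
      Finset.sum_le_sum fun i _ => mul_le_mul_of_nonneg_right (hMi i) (hy _)
    have h4 := mul_le_mul_of_nonneg_left (le_max_left (y (firstUser k)) (y (lastUser k))) hf
    have h5 := mul_le_mul_of_nonneg_left (le_max_right (y (firstUser k)) (y (lastUser k))) hl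
    have h6 := mul_le_mul_of_nonneg_right hM
      ((hy (firstUser k)).trans (le_max_left (y (firstUser k)) (y (lastUser k))))
    linarith
  have h3 : a * ∑ n, r n * y n ≤ a * (M * load y) := mul_le_mul_of_nonneg_left h2 ha.le
  -- Completing the square: `M * q - q ^ 2 / 2 ≤ M ^ 2 / 2`.
  have h4 : 0 ≤ a * (M - load y) ^ 2 := by positivity
  unfold surplus cost
  nlinarith

/-- For a fixed number of users, the efficiency is bounded away from `1 / 4`. -/
theorem efficiency_lower_bound {k : ℕ} {e : ℝ} (he : e ∈ efficiencies (1 / 2) k) :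
    1 / 4 + 1 / (100 * ((k : ℝ) + 1)) ≤ e := by
  obtain ⟨a, U, x, xS, ha, hU, hN, ⟨hS0, hS⟩, rfl⟩ := he
  obtain ⟨hx, hN1, hN2, hN3⟩ := (isNash_iff a U x).1 hN
  set R := ∑ i : Fin k, x (routingUser i) with hRdef
  have hR : 0 ≤ R := Finset.sum_nonneg fun i _ => hx _
  set u := x (firstUser k) with hudef
  set v := x (lastUser k) with hvdef
  have hq : load x = R + max u v := rfl
  have hmax : 0 ≤ max u v := (hx (firstUser k)).trans (le_max_left _ _)
  obtain ⟨r₁, r₂, hr1, hr2, hs1, hs2, hrq, hσ, hpay, hbound⟩ := exists_coding_supergradients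
    (hU (firstUser k)) (hU (lastUser k)) ha hR (hx (firstUser k)) (hx (lastUser k)) hN1 hN2
  have hs3 := fun i : Fin k => isSupergradient_routing (hU (routingUser i)) (hx _) (hN3 i)
  rw [← hq] at hrq hσ hpay hbound
  set q := load x with hqdef
  have hq0 : 0 < q := by
    by_contra hneg
    -- At zero load the supporting line of the first user would be flat, contradicting strict
    -- monotonicity.
    have hr0 : r₁ = 0 := by linarith
    have h1 := hs1 (u + 1) (by linarith [hx (firstUser k)])
    have h2 := (hU (firstUser k)).increasing (mem_Ici.2 (hx (firstUser k)))
      (mem_Ici.2 (show 0 ≤ u + 1 by linarith [hx (firstUser k)])) (lt_add_one u)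
    rw [hr0] at h1
    linarith
  set r : Fin (k + 2) → ℝ := fun n =>
    if n = firstUser k then r₁ else if n = lastUser k then r₂ else q + x n with hrdef
  have rf : r (firstUser k) = r₁ := by simp [hrdef]
  have rl : r (lastUser k) = r₂ := by simp [hrdef, (firstUser_ne_lastUser k).symm]
  have ri : ∀ i : Fin k, r (routingUser i) = q + x (routingUser i) := fun i => by
    simp [hrdef, routingUser_ne_firstUser, routingUser_ne_lastUser]
  have hs : ∀ n, IsSupergradient (U n) (x n) (a * r n) := by
    rw [forall_user_iff (p := fun n => IsSupergradient (U n) (x n) (a * r n)), rf, rl]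
    exact ⟨hs1, hs2, fun i => by rw [ri]; exact hs3 i⟩
  set Q := ∑ i : Fin k, x (routingUser i) ^ 2 with hQdef
  set F := Q + q * R + (r₁ * u + r₂ * v) - q ^ 2 / 2 with hFdef
  have hsum : ∑ n, r n * x n = Q + q * R + (r₁ * u + r₂ * v) := by
    rw [sum_univ_eq, rf, rl]
    simp only [ri, add_mul, Finset.sum_add_distrib, ← Finset.mul_sum, ← pow_two]
    ring
  set T := ∑ n, (U n (x n) - a * r n * x n) with hTdef
  have hT : 0 ≤ T := Finset.sum_nonneg fun n _ => by
    have h1 := hs n 0 le_rfl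
    have h2 := (hU n).nonneg 0 (mem_Ici.2 le_rfl)
    linarith
  have hSx : surplus a U x = T + a * F := by
    have : T = ∑ n, U n (x n) - a * ∑ n, r n * x n := by
      rw [hTdef, Finset.sum_sub_distrib, Finset.mul_sum]
      simp only [mul_assoc]
    rw [surplus, cost, this, hsum, hFdef, ← hqdef]
    ring
  -- `k + 1` rather than `k` keeps `d` positive and at most `1` even without routing users.
  set d : ℝ := 1 / ((k : ℝ) + 1) with hddef
  have hd0 : 0 < d := by positivity
  have hd1 : d ≤ 1 := by
    rw [hddef, div_le_one (by positivity)]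
    linarith [(Nat.cast_nonneg k : (0 : ℝ) ≤ k)]
  have hQ0 : 0 ≤ Q := Finset.sum_nonneg fun i _ => sq_nonneg _
  have hQd : d * R ^ 2 ≤ Q := by
    have h1 : R ^ 2 ≤ k * Q := by
      have := sq_sum_le_card_mul_sum_sq (s := (Finset.univ : Finset (Fin k)))
        (f := fun i => x (routingUser i))
      simpa using this
    rw [hddef, one_div, inv_mul_le_iff₀ (by positivity)]
    linarith
  have hc : (1 : ℝ) / 4 + 1 / (100 * ((k : ℝ) + 1)) = 1 / 4 + d / 100 := by
    rw [hddef]; field_simp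
  rw [hc]
  set c : ℝ := 1 / 4 + d / 100 with hcdef
  have hc0 : 0 < c := by positivity
  have hF1 : c / 2 * (r₁ + r₂) ^ 2 ≤ F := by
    have := hbound d hd0.le hd1
    rw [hcdef, hFdef]
    linarith
  -- Routing slopes are not critical: `q ^ 2 / 2 + Q ≤ F` already supports the constant `1 / 6`,
  -- above `c / 2`.
  have hF2 : ∀ i : Fin k, c / 2 * (q + x (routingUser i)) ^ 2 ≤ F := by
    intro i
    have h1 : x (routingUser i) ^ 2 ≤ Q :=
      Finset.single_le_sum (f := fun i : Fin k => x (routingUser i) ^ 2)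
        (fun i _ => sq_nonneg _) (Finset.mem_univ i)
    have h2 : q ^ 2 / 2 + Q ≤ F := by
      have h3 : max u v = q - R := by rw [hq]; ring
      rw [h3] at hpay
      rw [hFdef]
      linarith
    have h3 : c / 2 * (q + x (routingUser i)) ^ 2 ≤ 1 / 6 * (q + x (routingUser i)) ^ 2 :=
      mul_le_mul_of_nonneg_right (by rw [hcdef]; linarith) (sq_nonneg _)
    linarith [sq_nonneg (q - x (routingUser i)), sq_nonneg q, sq_nonneg (x (routingUser i))]
  have hF0 : 0 < F := by
    refine lt_of_lt_of_le ?_ hF1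
    have : 0 < r₁ + r₂ := by linarith
    positivity
  -- `√(2 * F / c)` is the largest `M` with `c * M ^ 2 / 2 ≤ F`; using it avoids a maximum over all
  -- slopes.
  have hM2 : √(2 * F / c) ^ 2 = 2 * F / c := Real.sq_sqrt (by positivity)
  have hle : surplus a U xS ≤ T + a * √(2 * F / c) ^ 2 / 2 := by
    refine surplus_le_of_isSupergradient ha hs hS0 (rf ▸ hr1) (rl ▸ hr2) ?_ fun i => ?_
    · rw [rf, rl]
      refine Real.le_sqrt_of_sq_le ?_
      rw [le_div_iff₀ hc0]
      linarith
    · rw [ri]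
      refine Real.le_sqrt_of_sq_le ?_
      rw [le_div_iff₀ hc0]
      linarith [hF2 i]
  have hpos : 0 < surplus a U xS := by
    have := hS x hx
    have : 0 < a * F := by positivity
    linarith
  rw [le_div_iff₀ hpos, hSx]
  have hcF : c * (a * √(2 * F / c) ^ 2 / 2) = a * F := by
    rw [hM2]; field_simp
  have h1 := mul_le_mul_of_nonneg_left hle hc0.le
  have h2 : c * T ≤ T := by
    exact mul_le_of_le_one_left hT (by rw [hcdef]; linarith)
  linarith

/-! ### Extremal examples with linear utilities -/

theorem isUtility_linear {c : ℝ} (hc : 0 < c) : IsUtility fun y => c * y where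
  concave := ((LinearMap.lsmul ℝ ℝ) c).concaveOn (convex_Ici 0)
  nonneg _ hx := mul_nonneg hc.le hx
  increasing := (strictMono_mul_left_of_pos hc).strictMonoOn _
  continuous := by fun_prop
  differentiable := by fun_prop

/-- `codingRate` for the two network coding users, `routingRate` for the routing users. -/
def twoLevel (k : ℕ) (codingRate routingRate : ℝ) (n : Fin (k + 2)) : ℝ :=
  if n = firstUser k ∨ n = lastUser k then codingRate else routingRate

@[simp] theorem twoLevel_first (k : ℕ) (b c : ℝ) : twoLevel k b c (firstUser k) = b := by
  simp [twoLevel]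

@[simp] theorem twoLevel_last (k : ℕ) (b c : ℝ) : twoLevel k b c (lastUser k) = b := by
  simp [twoLevel]

@[simp] theorem twoLevel_routing {k : ℕ} (b c : ℝ) (i : Fin k) :
    twoLevel k b c (routingUser i) = c := by
  simp [twoLevel, routingUser_ne_firstUser, routingUser_ne_lastUser]

theorem twoLevel_nonneg (k : ℕ) {b c : ℝ} (hb : 0 ≤ b) (hc : 0 ≤ c) (n : Fin (k + 2)) :
    0 ≤ twoLevel k b c n := by
  unfold twoLevel
  split_ifs <;> assumption

/-- Linear utilities with slope `1` for the network coding users and `c` for the routing users. -/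
def linearUtility (k : ℕ) (c : ℝ) (n : Fin (k + 2)) (y : ℝ) : ℝ := twoLevel k 1 c n * y

theorem isUtility_linearUtility (k : ℕ) {c : ℝ} (hc : 0 < c) (n : Fin (k + 2)) :
    IsUtility (linearUtility k c n) :=
  isUtility_linear (by unfold twoLevel; split_ifs <;> linarith)

theorem surplus_linearUtility {k : ℕ} (c : ℝ) (y : Fin (k + 2) → ℝ) :
    surplus 1 (linearUtility k c) y = y (firstUser k) + y (lastUser k) +
      c * (∑ i : Fin k, y (routingUser i)) - load y ^ 2 / 2 := by
  rw [surplus, cost, sum_univ_eq]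
  simp only [linearUtility, twoLevel_first, twoLevel_last, twoLevel_routing, Finset.mul_sum]
  ring

theorem surplus_linearUtility_twoLevel (k : ℕ) (c s t : ℝ) :
    surplus 1 (linearUtility k c) (twoLevel k s t) =
      2 * s + c * (k * t) - (k * t + s) ^ 2 / 2 := by
  rw [surplus_linearUtility, load]
  simp
  ring

/-- Serving the network coding users only is optimal when they value their rate most. -/
theorem isOptimal_linearUtility (k : ℕ) {c : ℝ} (hc : c ≤ 2) :
    IsOptimal 1 (linearUtility k c) (twoLevel k 2 0) := by
  refine ⟨twoLevel_nonneg k (by norm_num) le_rfl, fun y hy => ?_⟩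
  rw [surplus_linearUtility_twoLevel, surplus_linearUtility, load]
  have hR : 0 ≤ ∑ i : Fin k, y (routingUser i) := Finset.sum_nonneg fun i _ => hy _
  set R := ∑ i : Fin k, y (routingUser i)
  -- A unit of load is worth at most `2`, so the surplus is at most `2 * q - q ^ 2 / 2 ≤ 2`.
  have h1 := le_max_left (y (firstUser k)) (y (lastUser k))
  have h2 := le_max_right (y (firstUser k)) (y (lastUser k))
  nlinarith [sq_nonneg (R + max (y (firstUser k)) (y (lastUser k)) - 2)]

/-- Without routing users an efficiency of `3 / 4` occurs. -/
theorem three_quarters_mem_efficiencies : (3 / 4 : ℝ) ∈ efficiencies (1 / 2) 0 := by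
  refine ⟨1, linearUtility 0 1, twoLevel 0 1 0, twoLevel 0 2 0, one_pos,
    isUtility_linearUtility 0 one_pos, ?_, isOptimal_linearUtility 0 one_le_two, ?_⟩
  · rw [isNash_iff]
    have key : ∀ y : ℝ, 0 ≤ y → codingPayoff 1 0 1 (fun y => y) y ≤
        codingPayoff 1 0 1 (fun y => y) 1 := by
      intro y hy
      simp only [codingPayoff]
      rcases le_total y 1 with h | h
      · rw [min_eq_left h, max_eq_right h]; norm_num; linarith
      · rw [min_eq_right h, max_eq_left h]; norm_num; nlinarith
    have hf : linearUtility 0 1 (firstUser 0) = fun y => y := by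
      funext y; simp [linearUtility]
    have hl : linearUtility 0 1 (lastUser 0) = fun y => y := by
      funext y; simp [linearUtility]
    refine ⟨twoLevel_nonneg 0 zero_le_one le_rfl, ?_, ?_, fun i => i.elim0⟩
    · simpa [hf] using key
    · simpa [hl] using key
  · rw [surplus_linearUtility_twoLevel, surplus_linearUtility_twoLevel]
    norm_num

/-- Many small routing users keep the network coding users out of the network. -/
theorem quarter_add_mem_efficiencies {k : ℕ} (hk : 1 ≤ k) :
    (1 / 4 + 1 / (2 * (k : ℝ))) ∈ efficiencies (1 / 2) k := by
  have hk0 : (1 : ℝ) ≤ k := by exact_mod_cast hk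
  have hkpos : (0 : ℝ) < k := by linarith
  -- The routing users fill the load to `1`, where their marginal payment is `1 + t`, their utility
  -- slope; a silent coding user faces marginal payment `1`, also its slope. The surplus is `1 / 2 +
  -- t` against the optimum `2`.
  set t : ℝ := 1 / (k : ℝ) with ht
  have ht0 : 0 < t := by positivity
  have ht1 : t ≤ 1 := by rw [ht, div_le_one hkpos]; exact hk0
  have hkt : (k : ℝ) * t = 1 := by rw [ht]; field_simp
  refine ⟨1, linearUtility k (1 + t), twoLevel k 0 t, twoLevel k 2 0, one_pos,
    isUtility_linearUtility k (by linarith), ?_, isOptimal_linearUtility k (by linarith), ?_⟩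
  · rw [isNash_iff]
    have key : ∀ y : ℝ, 0 ≤ y → codingPayoff 1 1 0 (fun y => y) y ≤
        codingPayoff 1 1 0 (fun y => y) 0 := by
      intro y hy
      simp only [codingPayoff]
      rw [min_eq_right hy, max_eq_left hy]
      norm_num
      nlinarith
    have hf : linearUtility k (1 + t) (firstUser k) = fun y => y := by
      funext y; simp [linearUtility]
    have hl : linearUtility k (1 + t) (lastUser k) = fun y => y := by
      funext y; simp [linearUtility]
    have hsum : ∑ i : Fin k, twoLevel k 0 t (routingUser i) = 1 := by simp [hkt]
    refine ⟨twoLevel_nonneg k le_rfl ht0.le, ?_, ?_, fun i y hy => ?_⟩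
    · rw [hf, hsum, twoLevel_first, twoLevel_last]; exact key
    · rw [hl, hsum, twoLevel_first, twoLevel_last]; exact key
    · rw [load, hsum]
      simp only [linearUtility, twoLevel_first, twoLevel_last, twoLevel_routing, max_self]
      nlinarith [sq_nonneg (y - t)]
  · rw [surplus_linearUtility_twoLevel, surplus_linearUtility_twoLevel, hkt]
    have : 1 / (2 * (k : ℝ)) = t / 2 := by rw [ht]; field_simp
    rw [this]
    norm_num
    ring

/-! ### Infimum for each number of users, and its limit -/

/-- Needed for the real `sInf` to be a greatest lower bound; `k = 0` requires its own example, as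
the rate `1 / k` is unavailable there. -/
theorem efficiencies_nonempty (k : ℕ) : (efficiencies (1 / 2) k).Nonempty := by
  rcases Nat.eq_zero_or_pos k with rfl | hk
  · exact ⟨_, three_quarters_mem_efficiencies⟩
  · exact ⟨_, quarter_add_mem_efficiencies hk⟩

theorem isGLB_sInf_efficiencies (k : ℕ) :
    IsGLB (efficiencies (1 / 2) k) (sInf (efficiencies (1 / 2) k)) :=
  isGLB_csInf (efficiencies_nonempty k) ⟨_, fun _ he => efficiency_lower_bound he⟩

theorem quarter_lt_sInf_efficiencies (k : ℕ) : 1 / 4 < sInf (efficiencies (1 / 2) k) := by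
  have h : 1 / 4 + 1 / (100 * ((k : ℝ) + 1)) ≤ sInf (efficiencies (1 / 2) k) :=
    le_csInf (efficiencies_nonempty k) fun _ he => efficiency_lower_bound he
  have : 0 < 1 / (100 * ((k : ℝ) + 1)) := by positivity
  linarith

theorem tendsto_sInf_efficiencies :
    Filter.Tendsto (fun k => sInf (efficiencies (1 / 2) k)) Filter.atTop (nhds (1 / 4)) := by
  have hlim : Filter.Tendsto (fun k : ℕ => 1 / 4 + 1 / 2 * ((k : ℝ)⁻¹)) Filter.atTop
      (nhds (1 / 4 + 1 / 2 * 0)) :=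
    (tendsto_inv_atTop_nhds_zero_nat.const_mul _).const_add _
  rw [mul_zero, add_zero] at hlim
  refine tendsto_of_tendsto_of_tendsto_of_le_of_le' tendsto_const_nhds hlim
    (Filter.Eventually.of_forall fun k => (quarter_lt_sInf_efficiencies k).le) ?_
  filter_upwards [Filter.eventually_ge_atTop 1] with k hk
  have h := (isGLB_sInf_efficiencies k).1 (quarter_add_mem_efficiencies hk)
  calc _ ≤ _ := h
    _ = _ := by rw [one_div_mul_eq_div, one_div (2 * (k : ℝ)), mul_inv]; ring

theorem isPriceOfAnarchy_quarter : IsPriceOfAnarchy (1 / 2) (1 / 4) := by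
  refine ⟨?_, fun b hb => ge_of_tendsto' tendsto_sInf_efficiencies fun k =>
    (isGLB_sInf_efficiencies k).2 fun e he => hb (mem_iUnion.2 ⟨k, he⟩)⟩
  intro e he
  obtain ⟨k, hk⟩ := mem_iUnion.1 he
  exact (quarter_lt_sInf_efficiencies k).le.trans ((isGLB_sInf_efficiencies k).1 hk)

end Butterfly

/-- With `β = 1 / 2`, the price of anarchy is `1 / 4`, and the worst case is approached exactly as
the number of users tends to infinity: for each fixed number `k + 2` of users the worst-case
efficiency `w k` exceeds `1 / 4`, while `w k` tends to `1 / 4`. -/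
theorem theorem9 :
    Butterfly.IsPriceOfAnarchy (1 / 2) (1 / 4) ∧
    ∃ w : ℕ → ℝ,
      (∀ k : ℕ, IsGLB (Butterfly.efficiencies (1 / 2) k) (w k)) ∧
      (∀ k : ℕ, 1 / 4 < w k) ∧
      Filter.Tendsto w Filter.atTop (nhds (1 / 4)) :=
  ⟨Butterfly.isPriceOfAnarchy_quarter, fun k => sInf (Butterfly.efficiencies (1 / 2) k),
    Butterfly.isGLB_sInf_efficiencies, Butterfly.quarter_lt_sInf_efficiencies,
    Butterfly.tendsto_sInf_efficiencies⟩
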